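/- Let $k$ be a field. For a Hopf algebra $H$ over $k$ with multiplication $m$, comultiplication $\Delta$ and counit $\varepsilon$, put $\Phi_H=(\mathrm{id}\otimes m)(\Delta\otimes\mathrm{id})\colon H\otimes H\to H\otimes H$. A $k$-basis $\mathcal B$ of $H$ is called $\Phi$-set theoretic if for all $b,c\in\mathcal B$ there are $b',c'\in\mathcal B$ with $\Phi_H(b\otimes c)=b'\otimes c'$. (1) Let $H$ be a (not necessarily commutative or finite-dimensional) Hopf algebra over $k$ which is a domain, and let $\mathcal B$ be a $\Phi$-set theoretic basis of $H$. Then for every $b\in\mathcal B$ one has $\varepsilon(b)\neq 0$ and $\Delta(b)=\varepsilon(b)^{-1}\, b\otimes b$. (2) Let $\mathfrak g$ be a nonzero finite-dimensional Lie algebra over $k$. Then the universal enveloping algebra $U(\mathfrak g)$, with its standard Hopf algebra structure ($\Delta(x)=x\otimes 1+1\otimes x$ and $\varepsilon(x)=0$ for $x\in\mathfrak g$), has no $\Phi$-set theoretic basis. -/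

import Mathlib

open scoped TensorProduct

/-! ### The standard Hopf algebra structure on a universal enveloping algebra

`Δ(x) = x ⊗ 1 + 1 ⊗ x`, `ε(x) = 0` and `S(x) = -x` for `x` in the Lie algebra. -/

namespace UniversalEnvelopingAlgebra

section HopfStructure

universe u v

variable (R : Type u) (L : Type v) [CommRing R] [LieRing L] [LieAlgebra R L]

attribute [local instance 100] LieRing.ofAssociativeRing

/-- The universal enveloping algebra is generated, as an algebra, by the image of `ι`. -/
theorem induction_on_ι {P : UniversalEnvelopingAlgebra R L → Prop}
    (a : UniversalEnvelopingAlgebra R L)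
    (halg : ∀ r : R, P (algebraMap R _ r)) (hι : ∀ x : L, P (ι R x))
    (hmul : ∀ a b, P a → P b → P (a * b)) (hadd : ∀ a b, P a → P b → P (a + b)) : P a := by
  let s : Subalgebra R (UniversalEnvelopingAlgebra R L) :=
    { carrier := {a | P a}
      mul_mem' := fun {a b} ha hb => hmul a b ha hb
      add_mem' := fun {a b} ha hb => hadd a b ha hb
      algebraMap_mem' := halg }
  let f : L →ₗ⁅R⁆ s :=
    { toFun := fun x => ⟨ι R x, hι x⟩
      map_add' := fun x y => Subtype.ext (map_add (ι R) x y)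
      map_smul' := fun r x => Subtype.ext (map_smul (ι R) r x)
      map_lie' := fun {x y} => Subtype.ext (by
        simp [LieRing.of_associative_ring_bracket]) }
  have h : s.val.comp (lift R f) = AlgHom.id R _ := by
    ext x
    simp [f]
  have h2 : s.val (lift R f a) = a := DFunLike.congr_fun h a
  rw [← h2]
  exact (lift R f a).2

/-- The comultiplication: the algebra homomorphism with `ι x ↦ ι x ⊗ 1 + 1 ⊗ ι x`. -/
noncomputable def comulHom : UniversalEnvelopingAlgebra R L →ₐ[R]
    UniversalEnvelopingAlgebra R L ⊗[R] UniversalEnvelopingAlgebra R L :=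
  lift R
    { toFun := fun x => ι R x ⊗ₜ[R] 1 + 1 ⊗ₜ[R] ι R x
      map_add' := fun x y => by
        simp only [map_add, TensorProduct.add_tmul, TensorProduct.tmul_add]; abel
      map_smul' := fun r x => by
        simp only [map_smul, TensorProduct.smul_tmul', TensorProduct.tmul_smul, smul_add,
          RingHom.id_apply]
      map_lie' := fun {x y} => by
        simp only [LieHom.map_lie, LieRing.of_associative_ring_bracket, mul_add, add_mul,
          Algebra.TensorProduct.tmul_mul_tmul, one_mul, mul_one, TensorProduct.sub_tmul,
          TensorProduct.tmul_sub]
        abel }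

/-- The counit: the algebra homomorphism with `ι x ↦ 0`. -/
noncomputable def counitHom : UniversalEnvelopingAlgebra R L →ₐ[R] R :=
  lift R (0 : L →ₗ⁅R⁆ R)

/-- The antipode, as an algebra homomorphism to the opposite algebra: `ι x ↦ op (-ι x)`. -/
noncomputable def antipodeHom : UniversalEnvelopingAlgebra R L →ₐ[R]
    (UniversalEnvelopingAlgebra R L)ᵐᵒᵖ :=
  lift R
    { toFun := fun x => MulOpposite.op (-ι R x)
      map_add' := fun x y => by
        simp only [map_add, neg_add, MulOpposite.op_add]
      map_smul' := fun r x => by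
        simp only [map_smul, ← smul_neg, MulOpposite.op_smul, RingHom.id_apply]
      map_lie' := fun {x y} => by
        apply MulOpposite.unop_injective
        simp [LieRing.of_associative_ring_bracket] }

@[simp] theorem comulHom_ι (x : L) :
    comulHom R L (ι R x) = ι R x ⊗ₜ[R] 1 + 1 ⊗ₜ[R] ι R x :=
  lift_ι_apply R _ x

@[simp] theorem counitHom_ι (x : L) : counitHom R L (ι R x) = 0 :=
  lift_ι_apply R _ x

@[simp] theorem antipodeHom_ι (x : L) :
    antipodeHom R L (ι R x) = MulOpposite.op (-ι R x) :=
  lift_ι_apply R _ x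

noncomputable instance instBialgebra : Bialgebra R (UniversalEnvelopingAlgebra R L) :=
  Bialgebra.ofAlgHom (comulHom R L) (counitHom R L)
    (by
      apply hom_ext; apply LieHom.ext; intro x
      simp [-ι_apply, TensorProduct.add_tmul, TensorProduct.tmul_add,
        Algebra.TensorProduct.one_def, add_assoc])
    (by
      refine AlgHom.ext fun a => ?_
      induction a using induction_on_ι with
      | halg r => rw [AlgHom.commutes]; exact (AlgHom.commutes _ r).symm
      | hι x => simp [-ι_apply]
      | hmul a b ha hb => rw [map_mul, ha, hb]; exact (map_mul _ a b).symm
      | hadd a b ha hb => rw [map_add, ha, hb]; exact (map_add _ a b).symm)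
    (by apply hom_ext; apply LieHom.ext; intro x; simp [-ι_apply])

theorem comul_eq (a : UniversalEnvelopingAlgebra R L) :
    Coalgebra.comul (R := R) a = comulHom R L a := rfl

theorem counit_eq (a : UniversalEnvelopingAlgebra R L) :
    Coalgebra.counit (R := R) a = counitHom R L a := rfl

/-- The antipode, as a linear map. -/
noncomputable def antipodeLin :
    UniversalEnvelopingAlgebra R L →ₗ[R] UniversalEnvelopingAlgebra R L :=
  (MulOpposite.opLinearEquiv R).symm.toLinearMap ∘ₗ (antipodeHom R L).toLinearMap

theorem antipodeLin_mul (a b : UniversalEnvelopingAlgebra R L) :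
    antipodeLin R L (a * b) = antipodeLin R L b * antipodeLin R L a := by
  simp [antipodeLin]

theorem antipodeLin_one : antipodeLin R L 1 = 1 := by
  simp [antipodeLin]

@[simp] theorem antipodeLin_ι (x : L) : antipodeLin R L (ι R x) = -ι R x := by
  simp [-ι_apply, antipodeLin]

theorem antipode_left_aux (a : UniversalEnvelopingAlgebra R L) :
    ∀ t, LinearMap.mul' R _ ((antipodeLin R L).rTensor _ (comulHom R L a * t)) =
      counitHom R L a • LinearMap.mul' R _ ((antipodeLin R L).rTensor _ t) := by
  induction a using induction_on_ι with
  | halg r => intro t; rw [AlgHom.commutes, AlgHom.commutes, ← Algebra.smul_def]; simp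
  | hι x =>
    intro t
    induction t with
    | zero => simp
    | add s t hs ht => simp only [mul_add, map_add, hs, ht, smul_add]
    | tmul u v =>
      simp [-ι_apply, add_mul, antipodeLin_mul, mul_assoc]
  | hmul a b ha hb => intro t; rw [map_mul (comulHom R L), mul_assoc, ha, hb, map_mul, mul_smul]
  | hadd a b ha hb => intro t; rw [map_add, add_mul, map_add, map_add, ha, hb, map_add, add_smul]

theorem antipode_right_aux (a : UniversalEnvelopingAlgebra R L) :
    ∀ t, LinearMap.mul' R _ ((antipodeLin R L).lTensor _ (t * comulHom R L a)) =
      counitHom R L a • LinearMap.mul' R _ ((antipodeLin R L).lTensor _ t) := by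
  induction a using induction_on_ι with
  | halg r =>
    intro t; rw [AlgHom.commutes, AlgHom.commutes, ← Algebra.commutes, ← Algebra.smul_def]; simp
  | hι x =>
    intro t
    induction t with
    | zero => simp
    | add s t hs ht => simp only [add_mul, map_add, hs, ht, smul_add]
    | tmul u v =>
      simp [-ι_apply, mul_add, antipodeLin_mul, mul_assoc]
  | hmul a b ha hb =>
    intro t
    rw [map_mul (comulHom R L), ← mul_assoc, hb, ha, map_mul, mul_smul, smul_comm]
  | hadd a b ha hb => intro t; rw [map_add, mul_add, map_add, map_add, ha, hb, map_add, add_smul]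

noncomputable instance instHopfAlgebra : HopfAlgebra R (UniversalEnvelopingAlgebra R L) where
  antipode := antipodeLin R L
  mul_antipode_rTensor_comul := by
    ext a
    have h := antipode_left_aux R L a 1
    rw [mul_one] at h
    simpa [comul_eq, counit_eq, Algebra.TensorProduct.one_def, antipodeLin_one,
      Algebra.algebraMap_eq_smul_one] using h
  mul_antipode_lTensor_comul := by
    ext a
    have h := antipode_right_aux R L a 1
    rw [one_mul] at h
    simpa [comul_eq, counit_eq, Algebra.TensorProduct.one_def, antipodeLin_one,
      Algebra.algebraMap_eq_smul_one] using h

end HopfStructure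

end UniversalEnvelopingAlgebra

/-! ### `Φ`-set theoretic bases -/

/-- The map `Φ_H = (id ⊗ m)(Δ ⊗ id) : H ⊗ H → H ⊗ H`, that is `a ⊗ b ↦ a₍₁₎ ⊗ a₍₂₎ b`. -/
noncomputable def hopfPhi (k H : Type*) [Field k] [Ring H] [HopfAlgebra k H] :
    H ⊗[k] H →ₗ[k] H ⊗[k] H :=
  (LinearMap.mul' k H).lTensor H ∘ₗ (TensorProduct.assoc k H H H).toLinearMap ∘ₗ
    (Coalgebra.comul (R := k) (A := H)).rTensor H

/-- A `k`-basis `B` of the Hopf algebra `H` (as a subset) is `Φ`-set theoretic if `Φ_H (b ⊗ c)` is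
a pure tensor `b' ⊗ c'` of elements of `B`, for all `b, c ∈ B`. -/
structure IsPhiSetTheoreticBasis (k : Type*) {H : Type*} [Field k] [Ring H] [HopfAlgebra k H]
    (B : Set H) : Prop where
  linearIndependent : LinearIndependent k ((↑) : B → H)
  span_eq_top : Submodule.span k B = ⊤
  phi_tmul : ∀ b ∈ B, ∀ c ∈ B, ∃ b' ∈ B, ∃ c' ∈ B, hopfPhi k H (b ⊗ₜ[k] c) = b' ⊗ₜ[k] c'

/-! ### Consequences of the two counit identities; part (1). -/

section HopfPhi

variable {k H : Type*} [Field k] [Ring H] [HopfAlgebra k H]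

/-! Suppose `Φ(b ⊗ c) = Δ(b)(1 ⊗ c) = b' ⊗ c'`. Applying `ε ⊗ id` gives `bc = ε(b')c'`; applying `id
⊗ ε` gives `ε(c)b = ε(c')b'`. Hence `ε(c) ≠ 0` forces `b' = b` by linear independence, and such a
`c` exists because `ε(1) = 1`.

Part (1): then `bc = ε(b)c'`, and in a domain `bc ≠ 0`, so `ε(b) ≠ 0` for every `b ∈ B`. Therefore
`Φ(b ⊗ c) = ε(b)⁻¹ b ⊗ bc` for all `c ∈ B`; this is linear in `c`, and `c = 1` gives `Δ(b)`.

Part (2) does not go through part (1), so it does not need `U(𝔤)` to be a domain. Fix `c ∈ B` with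
`ε(c) ≠ 0`, so `Δ(b)(1 ⊗ c) = b ⊗ c'`. The leading part of `Δ(b)` for the word-length filtration is
`b ⊗ 1`, so a functional `f` with `f(b) = 1` that kills shorter words gives `c = c'`
(`exists_lid_rTensor_comul_eq_one`). Thus `bc = ε(b)c` for all `b ∈ B`: `c` is a left integral, and
`xc = 0` for `x ∈ 𝔤`. On the Poincaré–Birkhoff–Witt module the least basis vector acts injectively,
so `c` kills the empty monomial; but the constant term of `c` applied to that monomial is `ε(c)`, a
contradiction. -/

theorem hopfPhi_tmul (b c : H) :
    hopfPhi k H (b ⊗ₜ[k] c) = Coalgebra.comul (R := k) b * (1 ⊗ₜ[k] c) := by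
  have key : ∀ t : H ⊗[k] H, (LinearMap.mul' k H).lTensor H
      (TensorProduct.assoc k H H H (t ⊗ₜ[k] c)) = t * (1 ⊗ₜ[k] c) := by
    intro t
    induction t with
    | zero => simp
    | add s t hs ht => simp only [TensorProduct.add_tmul, map_add, hs, ht, add_mul]
    | tmul u v => simp
  simpa [hopfPhi] using key (Coalgebra.comul (R := k) b)

theorem lid_rTensor_mul_one_tmul (f : H →ₗ[k] k) (t : H ⊗[k] H) (c : H) :
    TensorProduct.lid k H (f.rTensor H (t * (1 ⊗ₜ[k] c))) =
      TensorProduct.lid k H (f.rTensor H t) * c := by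
  induction t with
  | zero => simp
  | add s t hs ht => simp only [map_add, hs, ht, add_mul]
  | tmul u v => simp

theorem rid_lTensor_counit_mul_one_tmul (t : H ⊗[k] H) (c : H) :
    TensorProduct.rid k H ((Coalgebra.counit (R := k)).lTensor H (t * (1 ⊗ₜ[k] c))) =
      Coalgebra.counit (R := k) c •
        TensorProduct.rid k H ((Coalgebra.counit (R := k)).lTensor H t) := by
  induction t with
  | zero => simp
  | add s t hs ht => simp only [map_add, hs, ht, add_mul, smul_add]
  | tmul u v => simp [smul_smul, mul_comm]

/-- Apply `ε ⊗ id` and the counit axiom for `Δ(b)`. -/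
theorem mul_eq_of_hopfPhi_tmul {b c b' c' : H}
    (h : hopfPhi k H (b ⊗ₜ[k] c) = b' ⊗ₜ[k] c') :
    b * c = Coalgebra.counit (R := k) b' • c' := by
  have h1 := congrArg (fun t => TensorProduct.lid k H
    ((Coalgebra.counit (R := k)).rTensor H t)) h
  simpa [hopfPhi_tmul, lid_rTensor_mul_one_tmul] using h1

/-- Apply `id ⊗ ε`, using that `ε` is multiplicative. -/
theorem counit_smul_eq_of_hopfPhi_tmul {b c b' c' : H}
    (h : hopfPhi k H (b ⊗ₜ[k] c) = b' ⊗ₜ[k] c') :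
    Coalgebra.counit (R := k) c • b = Coalgebra.counit (R := k) c' • b' := by
  have h1 := congrArg (fun t => TensorProduct.rid k H
    ((Coalgebra.counit (R := k)).lTensor H t)) h
  simpa [hopfPhi_tmul, rid_lTensor_counit_mul_one_tmul] using h1

namespace IsPhiSetTheoreticBasis

variable {B : Set H}

theorem ext_linearMap {M : Type*} [AddCommGroup M] [Module k M] (hB : IsPhiSetTheoreticBasis k B)
    {f g : H →ₗ[k] M} (h : ∀ b ∈ B, f b = g b) (a : H) : f a = g a :=
  DFunLike.congr_fun (LinearMap.ext_on hB.span_eq_top h) a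

theorem exists_counit_ne_zero (hB : IsPhiSetTheoreticBasis k B) :
    ∃ c ∈ B, Coalgebra.counit (R := k) c ≠ 0 := by
  by_contra! h
  have := hB.ext_linearMap (f := Coalgebra.counit (R := k) (A := H)) (g := 0) (by simpa using h) 1
  simp at this

theorem eq_of_smul_eq_smul (hB : IsPhiSetTheoreticBasis k B) {b b' : H} (hb : b ∈ B)
    (hb' : b' ∈ B) {r s : k} (hr : r ≠ 0) (h : r • b = s • b') : b = b' := by
  by_contra hne
  have hp : LinearIndepOn k id ({b, b'} : Set H) :=
    LinearIndepOn.mono (show LinearIndepOn k id B from hB.linearIndependent) (by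
      rintro x (rfl | rfl) <;> assumption)
  have := (LinearIndepOn.pair_iff id hne).1 hp r (-s) (by simp [h])
  exact hr this.1

/-- If `ε c ≠ 0`, then `Φ` fixes the first tensor factor of `b ⊗ c`. -/
theorem exists_hopfPhi_tmul_eq (hB : IsPhiSetTheoreticBasis k B) {b c : H} (hb : b ∈ B)
    (hc : c ∈ B) (hε : Coalgebra.counit (R := k) c ≠ 0) :
    ∃ c' ∈ B, hopfPhi k H (b ⊗ₜ[k] c) = b ⊗ₜ[k] c' := by
  obtain ⟨b', hb', c', hc', h⟩ := hB.phi_tmul b hb c hc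
  obtain rfl := hB.eq_of_smul_eq_smul hb hb' hε (counit_smul_eq_of_hopfPhi_tmul h)
  exact ⟨c', hc', h⟩

theorem counit_ne_zero [IsDomain H] (hB : IsPhiSetTheoreticBasis k B) {b : H} (hb : b ∈ B) :
    Coalgebra.counit (R := k) b ≠ 0 := by
  obtain ⟨c, hc, hε⟩ := hB.exists_counit_ne_zero
  obtain ⟨c', -, h⟩ := hB.exists_hopfPhi_tmul_eq hb hc hε
  intro h0
  have h1 := mul_eq_of_hopfPhi_tmul h
  rw [h0, zero_smul] at h1
  rcases mul_eq_zero.1 h1 with h2 | h2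
  · exact hB.linearIndependent.ne_zero ⟨b, hb⟩ h2
  · exact hB.linearIndependent.ne_zero ⟨c, hc⟩ h2

theorem comul_eq [IsDomain H] (hB : IsPhiSetTheoreticBasis k B) {b : H} (hb : b ∈ B) :
    Coalgebra.comul (R := k) b = (Coalgebra.counit (R := k) b)⁻¹ • (b ⊗ₜ[k] b) := by
  -- Both sides are linear in the second tensor factor, so agreement on `B` allows evaluation at
  -- `1`, which need not lie in `B`.
  have key := hB.ext_linearMap
    (f := hopfPhi k H ∘ₗ TensorProduct.mk k H H b)
    (g := (Coalgebra.counit (R := k) b)⁻¹ • (TensorProduct.mk k H H b ∘ₗ LinearMap.mulLeft k b))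
    (fun c hc => by
      obtain ⟨c', -, h⟩ := hB.exists_hopfPhi_tmul_eq hb hc (hB.counit_ne_zero hc)
      simp [h, mul_eq_of_hopfPhi_tmul h, smul_smul, inv_mul_cancel₀ (hB.counit_ne_zero hb)]) 1
  simpa [hopfPhi_tmul, ← Algebra.TensorProduct.one_def] using key

end IsPhiSetTheoreticBasis

end HopfPhi

/-! ### Word length and left integrals in the enveloping algebra. -/

namespace UniversalEnvelopingAlgebra

section Filtration

variable (R L : Type*) [CommRing R] [LieRing L] [LieAlgebra R L]

attribute [local instance 100] LieRing.ofAssociativeRing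

/-- The standard filtration of the enveloping algebra by word length, shifted by one:
`lengthFiltration R L n` is spanned by the products of fewer than `n` elements of `L`. -/
noncomputable def lengthFiltration : ℕ → Submodule R (UniversalEnvelopingAlgebra R L)
  | 0 => ⊥
  | n + 1 => Submodule.span R {1} ⊔ lengthFiltration n ⊔
      LinearMap.range (ι R : L →ₗ⁅R⁆ UniversalEnvelopingAlgebra R L).toLinearMap *
        lengthFiltration n

variable {R L}

theorem lengthFiltration_mono : Monotone (lengthFiltration R L) :=
  monotone_nat_of_le_succ fun _ => le_sup_of_le_left le_sup_right

theorem ι_mul_mem_lengthFiltration (x : L) {n : ℕ} {v : UniversalEnvelopingAlgebra R L}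
    (hv : v ∈ lengthFiltration R L n) : ι R x * v ∈ lengthFiltration R L (n + 1) :=
  Submodule.mem_sup_right (Submodule.mul_mem_mul ⟨x, rfl⟩ hv)

theorem exists_mem_lengthFiltration (a : UniversalEnvelopingAlgebra R L) :
    ∃ n, a ∈ lengthFiltration R L n := by
  -- The filtration is built by left multiplication, so the claim is strengthened to left
  -- multiplication by `a`, which composes along products.
  have key : ∀ n, ∀ v ∈ lengthFiltration R L n, ∃ m, a * v ∈ lengthFiltration R L m := by
    induction a using induction_on_ι with
    | halg r =>
      intro n v hv
      exact ⟨n, by rw [← Algebra.smul_def]; exact Submodule.smul_mem _ r hv⟩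
    | hι x => exact fun n v hv => ⟨n + 1, ι_mul_mem_lengthFiltration x hv⟩
    | hmul a b ha hb =>
      intro n v hv
      obtain ⟨m, hm⟩ := hb n v hv
      simpa only [mul_assoc] using ha m _ hm
    | hadd a b ha hb =>
      intro n v hv
      obtain ⟨p, hp⟩ := ha n v hv
      obtain ⟨q, hq⟩ := hb n v hv
      refine ⟨max p q, ?_⟩
      rw [add_mul]
      exact add_mem (lengthFiltration_mono (le_max_left p q) hp)
        (lengthFiltration_mono (le_max_right p q) hq)
  simpa using key 1 1
    (Submodule.mem_sup_left (Submodule.mem_sup_left (Submodule.mem_span_singleton_self 1)))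

/-- A functional `f` that kills the previous filtration step satisfies `(f ⊗ id) (Δ u) = f u`. -/
theorem lid_rTensor_comulHom (n : ℕ) {u : UniversalEnvelopingAlgebra R L}
    (hu : u ∈ lengthFiltration R L (n + 1)) :
    ∀ f : UniversalEnvelopingAlgebra R L →ₗ[R] R, (∀ v ∈ lengthFiltration R L n, f v = 0) →
      TensorProduct.lid R _ (f.rTensor _ (comulHom R L u)) =
        f u • (1 : UniversalEnvelopingAlgebra R L) := by
  induction n generalizing u with
  | zero =>
    intro f _
    have hu' : u ∈ Submodule.span R {1} := by simpa [lengthFiltration] using hu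
    obtain ⟨r, rfl⟩ := Submodule.mem_span_singleton.1 hu'
    simp [Algebra.TensorProduct.one_def, smul_smul]
  | succ n ih =>
    intro f hf
    have hone : (1 : UniversalEnvelopingAlgebra R L) ∈ lengthFiltration R L (n + 1) :=
      Submodule.mem_sup_left (Submodule.mem_sup_left (Submodule.mem_span_singleton_self 1))
    have low : ∀ v ∈ lengthFiltration R L (n + 1),
        TensorProduct.lid R _ (f.rTensor _ (comulHom R L v)) =
          f v • (1 : UniversalEnvelopingAlgebra R L) := fun v hv =>
      ih hv f fun w hw => hf w (lengthFiltration_mono n.le_succ hw)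
    rw [lengthFiltration, Submodule.mem_sup] at hu
    obtain ⟨v, hv, w, hw, rfl⟩ := hu
    have hv' : v ∈ lengthFiltration R L (n + 1) := by
      refine (sup_le ?_ le_rfl : Submodule.span R {1} ⊔ _ ≤ lengthFiltration R L (n + 1)) hv
      exact (Submodule.span_singleton_le_iff_mem _ _).2 hone
    have hw' : TensorProduct.lid R _ (f.rTensor _ (comulHom R L w)) =
        f w • (1 : UniversalEnvelopingAlgebra R L) := by
      induction hw using Submodule.mul_induction_on' with
      | add a ha b hb iha ihb => simp only [map_add, iha, ihb, add_smul]
      | mem_mul_mem a ha b hb =>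
        obtain ⟨x, rfl⟩ := ha
        -- In `Δ(x)Δ(b)` the summand `x ⊗ 1` replaces `f` by `f(x ·)`, which kills the step below
        -- that of `b`, so induction applies. The summand `1 ⊗ x` contributes `f(b)x = 0`.
        have h1 : ∀ t, TensorProduct.lid R _ (f.rTensor _
            ((ι R x ⊗ₜ[R] (1 : UniversalEnvelopingAlgebra R L)) * t)) =
            TensorProduct.lid R _ ((f ∘ₗ LinearMap.mulLeft R (ι R x)).rTensor _ t) := by
          intro t
          induction t with
          | zero => simp
          | add s t hs ht => simp only [mul_add, map_add, hs, ht]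
          | tmul u v => simp [-ι_apply]
        have h2 : ∀ t, TensorProduct.lid R _ (f.rTensor _
            (((1 : UniversalEnvelopingAlgebra R L) ⊗ₜ[R] ι R x) * t)) =
            ι R x * TensorProduct.lid R _ (f.rTensor _ t) := by
          intro t
          induction t with
          | zero => simp
          | add s t hs ht => simp only [mul_add, map_add, hs, ht]
          | tmul u v => simp [-ι_apply]
        have h3 := ih hb (f ∘ₗ LinearMap.mulLeft R (ι R x))
          fun w hw => hf _ (ι_mul_mem_lengthFiltration x hw)
        have h4 := low b hb
        rw [hf b hb, zero_smul] at h4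
        change TensorProduct.lid R _ (f.rTensor _ (comulHom R L (ι R x * b))) = _
        rw [map_mul, comulHom_ι, add_mul, map_add, map_add, h1, h2, h3, h4]
        simp [-ι_apply]
    rw [map_add, map_add, map_add, low v hv', hw', map_add, add_smul]

end Filtration

section Field

variable {k L : Type*} [Field k] [LieRing L] [LieAlgebra k L]

attribute [local instance 100] LieRing.ofAssociativeRing

/-- Every nonzero element of the enveloping algebra splits off: some functional `f` satisfies
`f u = 1` and `(f ⊗ id) (Δ u) = 1`. -/
theorem exists_lid_rTensor_comul_eq_one {u : UniversalEnvelopingAlgebra k L} (hu : u ≠ 0) :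
    ∃ f : UniversalEnvelopingAlgebra k L →ₗ[k] k, f u = 1 ∧
      TensorProduct.lid k _ (f.rTensor _ (Coalgebra.comul (R := k) u)) = 1 := by
  classical
  have hex := exists_mem_lengthFiltration (R := k) u
  obtain ⟨n, hn⟩ : ∃ n, Nat.find hex = n + 1 := by
    refine Nat.exists_eq_succ_of_ne_zero fun h0 => hu ?_
    have := Nat.find_spec hex
    rw [h0] at this
    simpa [lengthFiltration] using this
  have hmem : u ∈ lengthFiltration k L (n + 1) := hn ▸ Nat.find_spec hex
  have hnot : u ∉ lengthFiltration k L n := Nat.find_min hex (by omega)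
  obtain ⟨f, hfu, hf⟩ := Submodule.exists_le_ker_of_notMem hnot
  refine ⟨(f u)⁻¹ • f, by simp [hfu], ?_⟩
  rw [UniversalEnvelopingAlgebra.comul_eq, lid_rTensor_comulHom n hmem]
  · simp [hfu]
  · intro v hv
    have : f v = 0 := hf hv
    simp [this]

/-- In a `Φ`-set theoretic basis of an enveloping algebra, every element with nonzero counit is
a left integral. -/
theorem mul_eq_counit_smul_of_isPhiSetTheoreticBasis {B : Set (UniversalEnvelopingAlgebra k L)}
    (hB : IsPhiSetTheoreticBasis k B) {c : UniversalEnvelopingAlgebra k L} (hc : c ∈ B)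
    (hε : Coalgebra.counit (R := k) c ≠ 0) (a : UniversalEnvelopingAlgebra k L) :
    a * c = Coalgebra.counit (R := k) a • c := by
  refine hB.ext_linearMap (f := LinearMap.mulRight k c)
    (g := (Coalgebra.counit (R := k)).smulRight c) (fun b hb => ?_) a
  obtain ⟨c', -, h⟩ := hB.exists_hopfPhi_tmul_eq hb hc hε
  obtain ⟨f, hfb, hf⟩ := exists_lid_rTensor_comul_eq_one (hB.linearIndependent.ne_zero ⟨b, hb⟩)
  have h1 := congrArg (fun t => TensorProduct.lid k _ (f.rTensor _ t)) h
  simp only [hopfPhi_tmul, lid_rTensor_mul_one_tmul, hf, one_mul, LinearMap.rTensor_tmul, hfb,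
    TensorProduct.lid_tmul, one_smul] at h1
  rw [h1]
  simpa [h1] using mul_eq_of_hopfPhi_tmul h

end Field

end UniversalEnvelopingAlgebra

/-! ### The Poincaré–Birkhoff–Witt module

A Lie algebra with a linearly ordered basis `b` acts on the free module on the multisets of basis
indices in such a way that `b i` sends a monomial `m` to `i ::ₘ m` whenever `i ≤ j` for all
`j ∈ m`. -/

namespace PBWModule

open Finsupp

variable {k L ι : Type*} [CommRing k] [LieRing L] [LieAlgebra k L]

variable (k ι) in
/-- The span of the monomials of degree at most `n`. -/
noncomputable def degreeLE (n : ℕ) : Submodule k (Multiset ι →₀ k) :=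
  supported k k {m | m.card ≤ n}

theorem single_mem_degreeLE {m : Multiset ι} {n : ℕ} (h : m.card ≤ n) :
    single m (1 : k) ∈ degreeLE k ι n :=
  single_mem_supported k 1 h

theorem degreeLE_le {n : ℕ} {N : Submodule k (Multiset ι →₀ k)}
    (h : ∀ m : Multiset ι, m.card ≤ n → single m 1 ∈ N) : degreeLE k ι n ≤ N := by
  rw [degreeLE, supported_eq_span_single, Submodule.span_le]
  rintro _ ⟨m, hm, rfl⟩
  exact h m hm

theorem degreeLE_mono : Monotone (degreeLE k ι) := fun _ _ h =>
  supported_mono fun _ hm => le_trans hm h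

theorem mem_degreeLE (v : Multiset ι →₀ k) : ∃ n, v ∈ degreeLE k ι n :=
  ⟨v.support.sup Multiset.card, fun _ hm => Finset.le_sup (f := Multiset.card) hm⟩

theorem constr_apply_mem (b : Module.Basis ι k L) {f : ι → (Multiset ι →₀ k) →ₗ[k] (Multiset ι →₀ k)}
    {N : Submodule k (Multiset ι →₀ k)} {v : Multiset ι →₀ k} (h : ∀ i, f i v ∈ N) (x : L) :
    b.constr k f x v ∈ N := by
  rw [Module.Basis.constr_apply, Finsupp.sum, LinearMap.sum_apply]
  exact Submodule.sum_mem _ fun i _ => Submodule.smul_mem _ _ (h i)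

theorem constr_apply_congr (b : Module.Basis ι k L) {f g : ι → (Multiset ι →₀ k) →ₗ[k] (Multiset ι →₀ k)}
    {v : Multiset ι →₀ k} (h : ∀ i, f i v = g i v) (x : L) :
    b.constr k f x v = b.constr k g x v := by
  simp only [Module.Basis.constr_apply, Finsupp.sum, LinearMap.sum_apply, LinearMap.smul_apply, h]

/-- A map that is multiplication by `i` up to terms of lower degree raises degrees by at most
one. -/
theorem apply_mem_degreeLE_succ {f : (Multiset ι →₀ k) →ₗ[k] (Multiset ι →₀ k)} {i : ι}
    (hf : ∀ m : Multiset ι, f (single m 1) - single (i ::ₘ m) 1 ∈ degreeLE k ι m.card)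
    {n : ℕ} {v : Multiset ι →₀ k} (hv : v ∈ degreeLE k ι n) : f v ∈ degreeLE k ι (n + 1) := by
  refine degreeLE_le (N := (degreeLE k ι (n + 1)).comap f) (fun m hm => ?_) hv
  rw [Submodule.mem_comap, ← sub_add_cancel (f (single m 1)) (single (i ::ₘ m) 1)]
  exact add_mem (degreeLE_mono (by omega) (hf m)) (single_mem_degreeLE (by simpa using hm))

variable [LinearOrder ι]

theorem le_or_exists_cons (i : ι) (m : Multiset ι) :
    (∀ j ∈ m, i ≤ j) ∨ ∃ l m', m = l ::ₘ m' ∧ l < i ∧ ∀ j ∈ m', l ≤ j := by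
  by_cases h : ∀ j ∈ m, i ≤ j
  · exact Or.inl h
  · push Not at h
    obtain ⟨j, hj, hji⟩ := h
    have hne : m.toFinset.Nonempty := ⟨j, by simpa using hj⟩
    have hle : ∀ a ∈ m, m.toFinset.min' hne ≤ a := fun a ha =>
      Finset.min'_le _ _ (by simpa using ha)
    have hmem : m.toFinset.min' hne ∈ m := by simpa using Finset.min'_mem _ hne
    exact Or.inr ⟨_, m.erase _, (Multiset.cons_erase hmem).symm, (hle j hj).trans_lt hji,
      fun a ha => hle a (Multiset.mem_of_mem_erase ha)⟩

open Classical in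
/-- The action of the basis vectors, computed with recursion depth `d`. It is the final action on
monomials of degree at most `d`. -/
noncomputable def actAux (b : Module.Basis ι k L) :
    ℕ → ι → (Multiset ι →₀ k) →ₗ[k] (Multiset ι →₀ k)
  | 0 => fun i => lmapDomain k k (i ::ₘ ·)
  | d + 1 => fun i => linearCombination k fun m =>
      -- For `m = l m'` with `l` minimal and `l < i`, the rule is forced by `b_i b_l m' = b_l b_i m'
      -- + [b_i, b_l] m'`. In `b_i m' = i m' + w` the remainder `w` has lower degree, and `b_l (i
      -- m')` is the monomial `i m`.
      if h : ∃ p : ι × Multiset ι, m = p.1 ::ₘ p.2 ∧ p.1 < i ∧ ∀ j ∈ p.2, p.1 ≤ j then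
        single (i ::ₘ m) 1 +
          actAux b d h.choose.1 (actAux b d i (single h.choose.2 1) -
            single (i ::ₘ h.choose.2) 1) +
          b.constr k (actAux b d) ⁅b i, b h.choose.1⁆ (single h.choose.2 1)
      else single (i ::ₘ m) 1

variable (b : Module.Basis ι k L)

theorem actAux_single_of_le (d : ℕ) {i : ι} {m : Multiset ι} (h : ∀ j ∈ m, i ≤ j) :
    actAux b d i (single m 1) = single (i ::ₘ m) 1 := by
  cases d with
  | zero => simp [actAux]
  | succ d =>
    have hn : ¬ ∃ p : ι × Multiset ι,
        m = p.1 ::ₘ p.2 ∧ p.1 < i ∧ ∀ j ∈ p.2, p.1 ≤ j := by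
      rintro ⟨⟨l, m'⟩, rfl, hl, -⟩
      exact (h l (Multiset.mem_cons_self _ _)).not_gt hl
    rw [actAux, linearCombination_single, one_smul, dif_neg hn]

theorem actAux_succ_single_cons (d : ℕ) {i l : ι} {m : Multiset ι} (hl : l < i)
    (h : ∀ j ∈ m, l ≤ j) :
    actAux b (d + 1) i (single (l ::ₘ m) 1) = single (i ::ₘ l ::ₘ m) 1 +
      actAux b d l (actAux b d i (single m 1) - single (i ::ₘ m) 1) +
      b.constr k (actAux b d) ⁅b i, b l⁆ (single m 1) := by
  have hex : ∃ p : ι × Multiset ι,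
      l ::ₘ m = p.1 ::ₘ p.2 ∧ p.1 < i ∧ ∀ j ∈ p.2, p.1 ≤ j := ⟨(l, m), rfl, hl, h⟩
  -- The split-off index must be the minimum of the multiset, so the chosen decomposition is the
  -- given one.
  have huniq : ∀ p : ι × Multiset ι, l ::ₘ m = p.1 ::ₘ p.2 → (∀ j ∈ p.2, p.1 ≤ j) →
      p = (l, m) := by
    rintro ⟨l', m'⟩ h1 h2
    have hle : l' ≤ l := by
      rcases Multiset.mem_cons.1 (h1 ▸ Multiset.mem_cons_self l m) with h3 | h3
      · exact h3.ge
      · exact h2 _ h3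
    have hge : l ≤ l' := by
      rcases Multiset.mem_cons.1 (h1.symm ▸ Multiset.mem_cons_self l' m') with h3 | h3
      · exact h3.ge
      · exact h _ h3
    obtain rfl := le_antisymm hle hge
    rw [(Multiset.cons_inj_right l').1 h1]
  rw [actAux, linearCombination_single, one_smul, dif_pos hex,
    huniq _ hex.choose_spec.1 hex.choose_spec.2.2]

theorem actAux_single_sub_mem (d : ℕ) (i : ι) (m : Multiset ι) :
    actAux b d i (single m 1) - single (i ::ₘ m) 1 ∈ degreeLE k ι m.card := by
  induction d generalizing i m with
  | zero => simp [actAux]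
  | succ d ih =>
    rcases le_or_exists_cons i m with h | ⟨l, m, rfl, hl, h⟩
    · simp [actAux_single_of_le b _ h]
    · rw [actAux_succ_single_cons b d hl h, add_assoc, add_sub_cancel_left, Multiset.card_cons]
      exact add_mem (apply_mem_degreeLE_succ (ih l) (ih i m))
        (constr_apply_mem b (fun c => apply_mem_degreeLE_succ (ih c) (single_mem_degreeLE le_rfl)) _)

/-- Each recursive call acts on a vector of degree below that of the monomial, by
`actAux_single_sub_mem`, so depth beyond the degree changes nothing. -/
theorem actAux_succ_eq (d : ℕ) (i : ι) {v : Multiset ι →₀ k} (hv : v ∈ degreeLE k ι d) :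
    actAux b (d + 1) i v = actAux b d i v := by
  induction d generalizing i v with
  | zero =>
    refine degreeLE_le (N := LinearMap.eqLocus _ _) (fun m hm => ?_) hv
    obtain rfl : m = 0 := by simpa using hm
    rw [LinearMap.mem_eqLocus, actAux_single_of_le b _ (by simp), actAux_single_of_le b _ (by simp)]
  | succ d ih =>
    refine degreeLE_le (N := LinearMap.eqLocus _ _) (fun m hm => ?_) hv
    rw [LinearMap.mem_eqLocus]
    rcases le_or_exists_cons i m with h | ⟨l, m, rfl, hl, h⟩
    · rw [actAux_single_of_le b _ h, actAux_single_of_le b _ h]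
    · have hm' : m.card ≤ d := by simpa using hm
      have hs : ∀ c, actAux b (d + 1) c (single m 1) = actAux b d c (single m 1) :=
        fun c => ih c (single_mem_degreeLE hm')
      rw [actAux_succ_single_cons b _ hl h, actAux_succ_single_cons b _ hl h, hs,
        ih l (degreeLE_mono hm' (actAux_single_sub_mem b d i m)), constr_apply_congr b hs]

/-- The action of the basis vectors on the Poincaré–Birkhoff–Witt module. -/
noncomputable def basisAct (i : ι) : (Multiset ι →₀ k) →ₗ[k] (Multiset ι →₀ k) :=
  linearCombination k fun m => actAux b m.card i (single m 1)

theorem basisAct_eq_actAux {d : ℕ} (i : ι) {v : Multiset ι →₀ k} (hv : v ∈ degreeLE k ι d) :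
    basisAct b i v = actAux b d i v := by
  refine degreeLE_le (N := LinearMap.eqLocus _ _) (fun m hm => ?_) hv
  rw [LinearMap.mem_eqLocus, basisAct, linearCombination_single, one_smul]
  clear hv
  induction d, hm using Nat.le_induction with
  | base => rfl
  | succ d hd ih => rw [actAux_succ_eq b d i (single_mem_degreeLE hd), ← ih]

/-- The action of the Lie algebra on the Poincaré–Birkhoff–Witt module, as a linear map. -/
noncomputable def act : L →ₗ[k] Module.End k (Multiset ι →₀ k) :=
  b.constr k (basisAct b)

theorem act_basis (i : ι) : act b (b i) = basisAct b i :=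
  b.constr_basis k _ i

theorem act_basis_single_of_le {i : ι} {m : Multiset ι} (h : ∀ j ∈ m, i ≤ j) :
    act b (b i) (single m 1) = single (i ::ₘ m) 1 := by
  rw [act_basis, basisAct_eq_actAux b i (single_mem_degreeLE le_rfl), actAux_single_of_le b _ h]

theorem act_basis_single_sub_mem (i : ι) (m : Multiset ι) :
    act b (b i) (single m 1) - single (i ::ₘ m) 1 ∈ degreeLE k ι m.card := by
  rw [act_basis, basisAct_eq_actAux b i (single_mem_degreeLE le_rfl)]
  exact actAux_single_sub_mem b _ i m

/-- This is the recursion rule itself, once the depths are removed and `l i m` is recognised as `b_l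
(i m)`. -/
theorem act_basis_act_basis_single_of_lt {i l : ι} {m : Multiset ι} (hl : l < i)
    (h : ∀ j ∈ m, l ≤ j) :
    act b (b i) (act b (b l) (single m 1)) =
      act b (b l) (act b (b i) (single m 1)) + act b ⁅b i, b l⁆ (single m 1) := by
  have e1 : act b (b l) (act b (b i) (single m 1) - single (i ::ₘ m) 1) =
      actAux b m.card l (actAux b m.card i (single m 1) - single (i ::ₘ m) 1) := by
    rw [act_basis b l, basisAct_eq_actAux b l (act_basis_single_sub_mem b i m), act_basis,
      basisAct_eq_actAux b i (single_mem_degreeLE le_rfl)]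
  have e2 : act b ⁅b i, b l⁆ (single m 1) =
      b.constr k (actAux b m.card) ⁅b i, b l⁆ (single m 1) :=
    constr_apply_congr b (fun c => basisAct_eq_actAux b c (single_mem_degreeLE le_rfl)) _
  have e3 : act b (b i) (single (l ::ₘ m) 1) =
      actAux b (m.card + 1) i (single (l ::ₘ m) 1) := by
    rw [act_basis, basisAct_eq_actAux b i (single_mem_degreeLE (Multiset.card_cons l m).le)]
  have e4 : act b (b l) (single (i ::ₘ m) 1) = single (l ::ₘ i ::ₘ m) 1 :=
    act_basis_single_of_le b (by simpa using ⟨hl.le, h⟩)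
  rw [act_basis_single_of_le b h, e3, actAux_succ_single_cons b _ hl h, ← e1, ← e2, map_sub, e4,
    Multiset.cons_swap i l m]
  abel

/-- The defect of `act b` from being a Lie algebra homomorphism, at a vector `v`. -/
noncomputable def defect (v : Multiset ι →₀ k) : L →ₗ[k] L →ₗ[k] (Multiset ι →₀ k) :=
  LinearMap.mk₂ k
    (fun x y => act b x (act b y v) - act b y (act b x v) - act b ⁅x, y⁆ v)
    (fun x x' y => by simp; abel) (fun r x y => by simp [smul_sub])
    (fun x y y' => by simp; abel) (fun r x y => by simp [smul_sub])

/-- Induction on degree. The only case not built into the recursion is `l < j < i` with `l` minimal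
in the monomial; there `b_l` is moved to the left and the Jacobi identity closes the computation. -/
theorem act_lie_single (m : Multiset ι) (x y : L) :
    act b x (act b y (single m 1)) - act b y (act b x (single m 1)) =
      act b ⁅x, y⁆ (single m 1) := by
  suffices hmain : ∀ n, ∀ m : Multiset ι, m.card ≤ n → ∀ x y,
      act b x (act b y (single m 1)) - act b y (act b x (single m 1)) =
        act b ⁅x, y⁆ (single m 1) from hmain _ m le_rfl x y
  intro n
  induction n using Nat.strong_induction_on with
  | _ n ih =>
    intro m hm x y
    suffices hlt : ∀ i j, j < i →
        act b (b i) (act b (b j) (single m 1)) - act b (b j) (act b (b i) (single m 1)) =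
          act b ⁅b i, b j⁆ (single m 1) by
      -- The defect is bilinear and antisymmetric, so ordered pairs of basis vectors suffice.
      have h0 : defect b (single m 1) = 0 := by
        refine b.ext fun i => b.ext fun j => ?_
        change _ - _ - _ = (0 : Multiset ι →₀ k)
        rcases lt_trichotomy i j with h | rfl | h
        · rw [← neg_sub (act b (b j) _), hlt j i h, ← lie_skew (b i) (b j), map_neg, LinearMap.neg_apply, sub_self]
        · simp
        · rw [hlt i j h, sub_self]
      exact sub_eq_zero.1 (DFunLike.congr_fun (DFunLike.congr_fun h0 x) y)
    intro i j hji
    rcases le_or_exists_cons j m with h | ⟨l, m, rfl, hl, h⟩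
    · rw [act_basis_act_basis_single_of_lt b hji h, add_sub_cancel_left]
    · have hm' : m.card < n := by simpa [Nat.succ_le_iff] using hm
      have lower : ∀ v ∈ degreeLE k ι m.card, ∀ x y,
          act b x (act b y v) - act b y (act b x v) = act b ⁅x, y⁆ v := by
        intro v hv x y
        have := degreeLE_le (N := LinearMap.ker (act b x ∘ₗ act b y - act b y ∘ₗ act b x
          - act b ⁅x, y⁆)) (fun m' hm'' => by
            simp [ih m.card hm' m' hm'' x y]) hv
        exact sub_eq_zero.1 (by simpa using this)
      have swap : ∀ p q, l < p → l < q →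
          act b (b p) (act b (b l) (act b (b q) (single m 1))) =
            act b (b l) (act b (b p) (act b (b q) (single m 1))) +
              act b ⁅b p, b l⁆ (act b (b q) (single m 1)) := by
        intro p q hp hq
        -- Split `b_q m` into `q m`, in which `l` is still a lower bound, and a remainder of degree
        -- at most that of `m`, covered by induction.
        have h1 := act_basis_act_basis_single_of_lt b (m := q ::ₘ m) hp
          (by simpa using ⟨hq.le, h⟩)
        have h2 := lower _ (act_basis_single_sub_mem b q m) (b p) (b l)
        have h3 := sub_add_cancel (act b (b q) (single m 1)) (single (q ::ₘ m) 1)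
        rw [← h3]
        simp only [map_add]
        rw [h1, ← h2]
        abel
      have hil := swap i j (hl.trans hji) hl
      have hjl := swap j i hl (hl.trans hji)
      have hm0 := single_mem_degreeLE (k := k) (le_refl m.card)
      have c1 := lower _ hm0 (b i) (b j)
      have c2 := lower _ hm0 ⁅b i, b l⁆ (b j)
      have c3 := lower _ hm0 (b i) ⁅b j, b l⁆
      have c4 := lower _ hm0 ⁅b i, b j⁆ (b l)
      have c5 : ⁅⁅b i, b j⁆, b l⁆ = ⁅⁅b i, b l⁆, b j⁆ + ⁅b i, ⁅b j, b l⁆⁆ := by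
        rw [lie_lie, ← lie_skew ⁅b i, b l⁆ (b j)]; abel
      rw [← act_basis_single_of_le b h, act_basis_act_basis_single_of_lt b hl h,
        act_basis_act_basis_single_of_lt b (hl.trans hji) h, map_add, map_add, hil, hjl]
      rw [c5, map_add, LinearMap.add_apply, ← c2, ← c3, sub_eq_iff_eq_add] at c4
      rw [c4, ← c1, map_sub]
      abel

theorem act_lie (x y : L) (v : Multiset ι →₀ k) :
    act b x (act b y v) - act b y (act b x v) = act b ⁅x, y⁆ v := by
  have : act b x ∘ₗ act b y - act b y ∘ₗ act b x = act b ⁅x, y⁆ :=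
    Finsupp.lhom_ext' fun m => LinearMap.ext_ring (by simpa using act_lie_single b m x y)
  exact DFunLike.congr_fun this v

/-- Every term of the recursion is a nonempty monomial or lies in the span of images of shallower
actions. -/
theorem actAux_apply_zero (d : ℕ) (i : ι) (v : Multiset ι →₀ k) : actAux b d i v 0 = 0 := by
  induction d generalizing i v with
  | zero =>
    rw [actAux, lmapDomain_apply, mapDomain_of_notMem_range]
    rintro ⟨m, hm⟩
    exact Multiset.cons_ne_zero hm
  | succ d ih =>
    suffices h : lapply 0 ∘ₗ actAux b (d + 1) i = 0 from DFunLike.congr_fun h v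
    refine Finsupp.lhom_ext' fun m => LinearMap.ext_ring ?_
    change actAux b (d + 1) i (single m 1) 0 = 0
    rcases le_or_exists_cons i m with h | ⟨l, m, rfl, hl, h⟩
    · rw [actAux_single_of_le b _ h, single_eq_of_ne (Multiset.cons_ne_zero).symm]
    · have := constr_apply_mem b (N := LinearMap.ker (lapply (R := k) (0 : Multiset ι)))
        (f := actAux b d) (v := single m 1) (fun c => ih c _) ⁅b i, b l⁆
      rw [actAux_succ_single_cons b d hl h, Finsupp.add_apply, Finsupp.add_apply, ih,
        single_eq_of_ne (Multiset.cons_ne_zero).symm, zero_add, zero_add]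
      exact this

/-- The vectors in the image of the action have no constant term. -/
theorem act_apply_zero (x : L) (v : Multiset ι →₀ k) : act b x v 0 = 0 := by
  refine constr_apply_mem b (N := LinearMap.ker (lapply (R := k) (0 : Multiset ι)))
    (f := basisAct b) (fun i => ?_) x
  obtain ⟨n, hn⟩ := mem_degreeLE v
  rw [basisAct_eq_actAux b i hn]
  exact actAux_apply_zero b n i v

/-- The smallest basis vector acts injectively. -/
theorem act_basis_injective {i : ι} (hi : ∀ j, i ≤ j) : Function.Injective (act b (b i)) := by
  have : act b (b i) = lmapDomain k k (i ::ₘ ·) :=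
    Finsupp.lhom_ext' fun m => LinearMap.ext_ring (by
      simpa using act_basis_single_of_le b (m := m) fun j _ => hi j)
  rw [this]
  exact mapDomain_injective fun _ _ h => (Multiset.cons_inj_right i).1 h

attribute [local instance 100] LieRing.ofAssociativeRing

/-- The Poincaré–Birkhoff–Witt representation of the Lie algebra. -/
noncomputable def rep : L →ₗ⁅k⁆ Module.End k (Multiset ι →₀ k) :=
  { act b with
    map_lie' := fun {x y} => LinearMap.ext fun v => (act_lie b x y v).symm }

/-- The constant term is a module map onto the trivial module, since Lie algebra elements produce no
constant term. -/
theorem lift_rep_apply_zero (u : UniversalEnvelopingAlgebra k L) (v : Multiset ι →₀ k) :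
    UniversalEnvelopingAlgebra.lift k (rep b) u v 0 =
      Coalgebra.counit (R := k) u * v 0 := by
  rw [UniversalEnvelopingAlgebra.counit_eq]
  induction u using UniversalEnvelopingAlgebra.induction_on_ι generalizing v with
  | halg r => simp [Module.algebraMap_end_apply]
  | hι x =>
    rw [UniversalEnvelopingAlgebra.lift_ι_apply, UniversalEnvelopingAlgebra.counitHom_ι, zero_mul]
    exact act_apply_zero b x v
  | hmul a c ha hc => rw [map_mul, map_mul, Module.End.mul_apply, ha, hc, mul_assoc]
  | hadd a c ha hc => rw [map_add, map_add, LinearMap.add_apply, Finsupp.add_apply, ha, hc, add_mul]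

/-- An element annihilated by left multiplication by the smallest basis vector has counit zero. -/
theorem counit_eq_zero_of_ι_mul_eq_zero {i : ι} (hi : ∀ j, i ≤ j)
    {u : UniversalEnvelopingAlgebra k L} (hu : UniversalEnvelopingAlgebra.ι k (b i) * u = 0) :
    Coalgebra.counit (R := k) u = 0 := by
  have h1 : act b (b i) (UniversalEnvelopingAlgebra.lift k (rep b) u (single 0 1)) = 0 := by
    have := congrArg (UniversalEnvelopingAlgebra.lift k (rep b)) hu
    rw [map_mul, UniversalEnvelopingAlgebra.lift_ι_apply, map_zero] at this
    exact DFunLike.congr_fun this (single 0 1)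
  have h2 := act_basis_injective b hi (h1.trans (map_zero _).symm)
  have h3 := lift_rep_apply_zero b u (single 0 1)
  rw [h2] at h3
  simpa using h3.symm

end PBWModule

theorem theorem6p7 {k : Type*} [Field k] :
    (∀ (H : Type*) [Ring H] [IsDomain H] [HopfAlgebra k H] (B : Set H),
      IsPhiSetTheoreticBasis k B → ∀ b ∈ B,
        Coalgebra.counit (R := k) b ≠ 0 ∧
        Coalgebra.comul (R := k) b = (Coalgebra.counit (R := k) b)⁻¹ • (b ⊗ₜ[k] b)) ∧
    (∀ (𝔤 : Type*) [LieRing 𝔤] [LieAlgebra k 𝔤] [FiniteDimensional k 𝔤] [Nontrivial 𝔤],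
      ¬ ∃ B : Set (UniversalEnvelopingAlgebra k 𝔤), IsPhiSetTheoreticBasis k B) := by
  refine ⟨fun H _ _ _ B hB b hb => ⟨hB.counit_ne_zero hb, hB.comul_eq hb⟩, ?_⟩
  rintro 𝔤 _ _ _ _ ⟨B, hB⟩
  obtain ⟨c, hc, hε⟩ := hB.exists_counit_ne_zero
  -- A nonzero finite-dimensional `𝔤` has a basis indexed by a nonempty `Fin`, whose index `0` is
  -- the required least one.
  have h0 : 0 < Module.finrank k 𝔤 := Module.finrank_pos
  refine hε (PBWModule.counit_eq_zero_of_ι_mul_eq_zero (Module.finBasis k 𝔤) (i := ⟨0, h0⟩)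
    (fun j => Nat.zero_le j) ?_)
  rw [UniversalEnvelopingAlgebra.mul_eq_counit_smul_of_isPhiSetTheoreticBasis hB hc hε,
    UniversalEnvelopingAlgebra.counit_eq, UniversalEnvelopingAlgebra.counitHom_ι, zero_smul]
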